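/- Let $\lambda$ denote Lebesgue measure on $\mathbb C$, let $\varphi(z)=|z|^2$, let $L^2_\varphi$ be the Hilbert space of (classes of) measurable functions $f:\mathbb C\to\mathbb C$ with $\|f\|_\varphi^2=\int_{\mathbb C}|f(z)|^2e^{-2\varphi(z)}\,d\lambda(z)<\infty$, and let $A^2_\varphi\subset L^2_\varphi$ be the subspace of entire functions. Then there is exactly one bounded linear operator $S:L^2_\varphi\to L^2_\varphi$ such that for every $f\in L^2_\varphi$ one has $\overline\partial S(f)=f$ in the sense of distributions (where $\overline\partial=\partial/\partial\overline z$) and $S(f)\perp A^2_\varphi$. This operator, the canonical solution operator to $\overline\partial$ on $L^2_\varphi$, is not compact. -/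

import Mathlib

open MeasureTheory Complex
open scoped ContDiff

noncomputable section

/-- The measure `e^{-2φ} dλ` on `ℂ`, where `λ` is Lebesgue measure. -/
def weightedMeasure (φ : ℂ → ℝ) : Measure ℂ :=
  (volume : Measure ℂ).withDensity fun z => ENNReal.ofReal (Real.exp (-2 * φ z))

/-- The Hilbert space `L²_φ` of measurable `f : ℂ → ℂ` (modulo null sets) with
`∫ |f|² e^{-2φ} dλ < ∞`, with its usual inner product. -/
abbrev WeightedL2 (φ : ℂ → ℝ) : Type :=
  Lp ℂ 2 (weightedMeasure φ)

/-- The space `A²_φ` of (classes of) entire functions belonging to `L²_φ`. -/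
def entireL2 (φ : ℂ → ℝ) : Submodule ℂ (WeightedL2 φ) where
  carrier := {h | ∃ g : ℂ → ℂ, Differentiable ℂ g ∧ h =ᵐ[weightedMeasure φ] g}
  zero_mem' := ⟨0, differentiable_const 0, Lp.coeFn_zero ℂ 2 (weightedMeasure φ)⟩
  add_mem' := by
    rintro a b ⟨g, hg, hag⟩ ⟨k, hk, hbk⟩
    exact ⟨g + k, hg.add hk, (Lp.coeFn_add a b).trans (hag.add hbk)⟩
  smul_mem' := by
    rintro c a ⟨g, hg, hag⟩
    exact ⟨c • g, hg.const_smul c, (Lp.coeFn_smul c a).trans (hag.const_smul c)⟩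

/-- The classical Wirtinger derivative `∂ψ/∂z̄ = ½ (∂ψ/∂x + i ∂ψ/∂y)`. -/
def dbar (ψ : ℂ → ℂ) (z : ℂ) : ℂ :=
  (1 / 2 : ℂ) * (fderiv ℝ ψ z 1 + I * fderiv ℝ ψ z I)

/-- `∂̄ u = f` in the sense of distributions: `∫ u ∂̄ψ dλ = - ∫ f ψ dλ` for all test functions
`ψ ∈ C_c^∞(ℂ)`. (Meant for locally integrable `u` and `f`.) -/
def IsWeakDbar (u f : ℂ → ℂ) : Prop :=
  ∀ ψ : ℂ → ℂ, ContDiff ℝ ∞ ψ → HasCompactSupport ψ →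
    ∫ z, u z * dbar ψ z = -∫ z, f z * ψ z

/-- `S` is a canonical solution operator to `∂̄` on `L²_φ`: for every `f ∈ L²_φ`,
`∂̄ (S f) = f` and `S f ⊥ A²_φ`. -/
def IsCanonicalSolutionOperator (φ : ℂ → ℝ) (S : WeightedL2 φ →L[ℂ] WeightedL2 φ) : Prop :=
  ∀ f : WeightedL2 φ, IsWeakDbar (S f) f ∧ S f ∈ (entireL2 φ)ᗮ

end

/-! Put ∂̄*ψ = -∂ψ + 2 z̄ ψ for test functions ψ. Then ∂̄u = f holds weakly exactly when ⟨∂̄*ψ, u⟩ =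
⟨ψ, f⟩ for all ψ (`isWeakDbar_iff_inner`). Since ∂̄(2 z̄) = 2, one has ∂̄∂̄* = ∂̄*∂̄ + 2, which
yields the estimate `two_mul_norm_sq_le`.

Existence: by the estimate, ∂̄*ψ ↦ ψ extends to a bounded operator on the closed range of ∂̄*.
Precompose it with the orthogonal projection and take the adjoint. The result solves ∂̄ and is
orthogonal to A²_φ, because the range of ∂̄* is. Uniqueness: the difference of two solutions is
annihilated by ∂̄, hence entire by Weyl's lemma, and also orthogonal to A²_φ.

Non-compactness: the weighted translations ψ(z - a) e^{2āz - |a|²} are isometries commuting with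
∂̄*. For translates χₙ of one ψ with disjoint supports, pairing S χₘ - S χₙ with ∂̄*χₘ gives ‖ψ‖² ≤
‖∂̄*ψ‖ ‖S χₘ - S χₙ‖. So a bounded sequence has uniformly separated images. -/

open scoped ComplexConjugate
open Set

/-! ### Calculus of the Wirtinger derivatives -/

/-- The Wirtinger derivative `∂ψ/∂z = ½ (∂ψ/∂x - i ∂ψ/∂y)`. -/
noncomputable def wirtinger (ψ : ℂ → ℂ) (z : ℂ) : ℂ :=
  (1 / 2 : ℂ) * (fderiv ℝ ψ z 1 - I * fderiv ℝ ψ z I)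

theorem dbar_add {f g : ℂ → ℂ} {z : ℂ} (hf : DifferentiableAt ℝ f z)
    (hg : DifferentiableAt ℝ g z) : dbar (fun w => f w + g w) z = dbar f z + dbar g z := by
  simp only [dbar, fderiv_fun_add hf hg, add_apply]; ring

theorem dbar_mul {f g : ℂ → ℂ} {z : ℂ} (hf : DifferentiableAt ℝ f z)
    (hg : DifferentiableAt ℝ g z) :
    dbar (fun w => f w * g w) z = dbar f z * g z + f z * dbar g z := by
  simp only [dbar, fderiv_fun_mul hf hg, add_apply,
    smul_apply, smul_eq_mul]; ring

theorem wirtinger_add {f g : ℂ → ℂ} {z : ℂ} (hf : DifferentiableAt ℝ f z)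
    (hg : DifferentiableAt ℝ g z) :
    wirtinger (fun w => f w + g w) z = wirtinger f z + wirtinger g z := by
  simp only [wirtinger, fderiv_fun_add hf hg, add_apply]; ring

theorem wirtinger_mul {f g : ℂ → ℂ} {z : ℂ} (hf : DifferentiableAt ℝ f z)
    (hg : DifferentiableAt ℝ g z) :
    wirtinger (fun w => f w * g w) z = wirtinger f z * g z + f z * wirtinger g z := by
  simp only [wirtinger, fderiv_fun_mul hf hg, add_apply,
    smul_apply, smul_eq_mul]; ring

theorem dbar_const_mul (c : ℂ) {f : ℂ → ℂ} {z : ℂ} (hf : DifferentiableAt ℝ f z) :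
    dbar (fun w => c * f w) z = c * dbar f z := by
  simp only [dbar, fderiv_const_mul hf, smul_apply, smul_eq_mul]; ring

theorem wirtinger_const_mul (c : ℂ) {f : ℂ → ℂ} {z : ℂ} (hf : DifferentiableAt ℝ f z) :
    wirtinger (fun w => c * f w) z = c * wirtinger f z := by
  simp only [wirtinger, fderiv_const_mul hf, smul_apply, smul_eq_mul]; ring

theorem fderiv_conj_apply {f : ℂ → ℂ} {z : ℂ} (hf : DifferentiableAt ℝ f z) (v : ℂ) :
    fderiv ℝ (fun w => conj (f w)) z v = conj (fderiv ℝ f z v) := by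
  have := (conjCLE.toContinuousLinearMap.hasFDerivAt (x := f z)).comp z hf.hasFDerivAt
  have h2 : fderiv ℝ (fun w => conj (f w)) z = _ := this.fderiv
  rw [h2]; simp

theorem dbar_conj {f : ℂ → ℂ} {z : ℂ} (hf : DifferentiableAt ℝ f z) :
    dbar (fun w => conj (f w)) z = conj (wirtinger f z) := by
  simp only [dbar, wirtinger, fderiv_conj_apply hf, map_mul, map_sub, conj_I]
  simp only [map_div₀, map_one, Complex.conj_ofNat]; ring

theorem dbar_eq_zero_of_differentiableAt {f : ℂ → ℂ} {z : ℂ} (hf : DifferentiableAt ℂ f z) :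
    dbar f z = 0 := by
  rw [dbar, (differentiableAt_complex_iff_differentiableAt_real.1 hf).2, smul_eq_mul,
    ← mul_assoc, I_mul_I]
  ring

theorem differentiableAt_of_dbar_eq_zero {f : ℂ → ℂ} {z : ℂ} (hf : DifferentiableAt ℝ f z)
    (h : dbar f z = 0) : DifferentiableAt ℂ f z := by
  refine differentiableAt_complex_iff_differentiableAt_real.2 ⟨hf, ?_⟩
  have h1 : fderiv ℝ f z 1 + I * fderiv ℝ f z I = 0 := by simpa [dbar] using h
  rw [smul_eq_mul]
  linear_combination (-I) * h1 + fderiv ℝ f z I * I_mul_I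

theorem wirtinger_eq_deriv {f : ℂ → ℂ} {z : ℂ} (hf : DifferentiableAt ℂ f z) :
    wirtinger f z = deriv f z := by
  have h1 : fderiv ℝ f z 1 = deriv f z := by
    rw [hf.fderiv_restrictScalars ℝ]; simp
  rw [wirtinger, (differentiableAt_complex_iff_differentiableAt_real.1 hf).2, smul_eq_mul,
    ← mul_assoc, I_mul_I, h1]
  ring

theorem ContDiff.fderiv_apply_const {f : ℂ → ℂ} (hf : ContDiff ℝ ∞ f) (v : ℂ) :
    ContDiff ℝ ∞ fun z => fderiv ℝ f z v :=
  (hf.fderiv_right (m := ∞) (by simp)).clm_apply contDiff_const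

theorem ContDiff.dbar {f : ℂ → ℂ} (hf : ContDiff ℝ ∞ f) : ContDiff ℝ ∞ (dbar f) := by
  have h1 := hf.fderiv_apply_const 1
  have h2 := hf.fderiv_apply_const I
  unfold _root_.dbar; fun_prop

theorem ContDiff.wirtinger {f : ℂ → ℂ} (hf : ContDiff ℝ ∞ f) : ContDiff ℝ ∞ (wirtinger f) := by
  have h1 := hf.fderiv_apply_const 1
  have h2 := hf.fderiv_apply_const I
  unfold _root_.wirtinger; fun_prop

theorem HasCompactSupport.dbar {f : ℂ → ℂ} (hf : HasCompactSupport f) :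
    HasCompactSupport (dbar f) := by
  refine (hf.fderiv (𝕜 := ℝ)).mono fun z hz => ?_
  contrapose! hz
  simp only [Function.mem_support, not_not] at hz ⊢
  simp [_root_.dbar, hz]

theorem HasCompactSupport.wirtinger {f : ℂ → ℂ} (hf : HasCompactSupport f) :
    HasCompactSupport (wirtinger f) := by
  refine (hf.fderiv (𝕜 := ℝ)).mono fun z hz => ?_
  contrapose! hz
  simp only [Function.mem_support, not_not] at hz ⊢
  simp [_root_.wirtinger, hz]

/-- Symmetry of the second real derivative; it cancels the second-order terms in the commutator of
∂̄ and ∂̄*. -/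
theorem dbar_wirtinger_comm {f : ℂ → ℂ} (hf : ContDiff ℝ ∞ f) (z : ℂ) :
    dbar (wirtinger f) z = wirtinger (dbar f) z := by
  have hd : ∀ v, DifferentiableAt ℝ (fun z => fderiv ℝ f z v) z := fun v =>
    (hf.fderiv_apply_const v).differentiable (by simp) z
  have hd' : DifferentiableAt ℝ (fderiv ℝ f) z :=
    (hf.fderiv_right (m := ∞) (by simp)).differentiable (by simp) z
  have key : ∀ v w, fderiv ℝ (fun z => fderiv ℝ f z v) z w = fderiv ℝ (fderiv ℝ f) z w v := by
    intro v w
    rw [fderiv_clm_apply hd' (differentiableAt_const v)]; simp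
  have hsymm : fderiv ℝ (fderiv ℝ f) z 1 I = fderiv ℝ (fderiv ℝ f) z I 1 :=
    ((contDiff_infty.1 hf 2).contDiffAt.isSymmSndFDerivAt (by simp)) 1 I
  have e1 : ∀ w, fderiv ℝ (wirtinger f) z w = (1 / 2 : ℂ) *
      (fderiv ℝ (fderiv ℝ f) z w 1 - I * fderiv ℝ (fderiv ℝ f) z w I) := by
    intro w
    have : wirtinger f = fun z => (1 / 2 : ℂ) * (fderiv ℝ f z 1 - I * fderiv ℝ f z I) := rfl
    have h2 := (((hd 1).hasFDerivAt.fun_sub ((hd I).hasFDerivAt.const_mul I)).const_mul (1 / 2 : ℂ)).fderiv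
    rw [this, h2]
    simp [key]
  have e2 : ∀ w, fderiv ℝ (dbar f) z w = (1 / 2 : ℂ) *
      (fderiv ℝ (fderiv ℝ f) z w 1 + I * fderiv ℝ (fderiv ℝ f) z w I) := by
    intro w
    have : dbar f = fun z => (1 / 2 : ℂ) * (fderiv ℝ f z 1 + I * fderiv ℝ f z I) := rfl
    have h2 := (((hd 1).hasFDerivAt.fun_add ((hd I).hasFDerivAt.const_mul I)).const_mul (1 / 2 : ℂ)).fderiv
    rw [this, h2]
    simp [key, mul_add]
  rw [dbar, wirtinger, e1, e1, e2, e2, hsymm]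
  ring

/-- A smooth function has its classical `∂̄`-derivative as its distributional one. -/
theorem isWeakDbar_dbar {u : ℂ → ℂ} (hu : ContDiff ℝ ∞ u) : IsWeakDbar u (dbar u) := by
  intro ψ hψ hc
  have hu0 := hu.continuous
  have hψ0 := hψ.continuous
  have hu' : ∀ v, Continuous fun z => fderiv ℝ u z v := fun v => (hu.fderiv_apply_const v).continuous
  have hψ' : ∀ v, Continuous fun z => fderiv ℝ ψ z v := fun v => (hψ.fderiv_apply_const v).continuous
  have hc' : ∀ v, HasCompactSupport fun z => fderiv ℝ ψ z v := fun v => hc.fderiv_apply ℝ v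
  have i1 : ∀ v, Integrable fun z => u z * fderiv ℝ ψ z v := fun v =>
    (hu0.mul (hψ' v)).integrable_of_hasCompactSupport (hc' v).mul_left
  have i2 : ∀ v, Integrable fun z => fderiv ℝ u z v * ψ z := fun v =>
    ((hu' v).mul hψ0).integrable_of_hasCompactSupport hc.mul_left
  have i3 : Integrable fun z => u z * ψ z :=
    (hu0.mul hψ0).integrable_of_hasCompactSupport hc.mul_left
  have hp : ∀ v, ∫ z, u z * fderiv ℝ ψ z v = -∫ z, fderiv ℝ u z v * ψ z := fun v =>
    integral_mul_fderiv_eq_neg_fderiv_mul_of_integrable (i2 v) (i1 v) i3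
      (fun z _ => hu.differentiable (by simp) z) (fun z _ => hψ.differentiable (by simp) z)
  calc ∫ z, u z * dbar ψ z
      = ∫ z, ((1 / 2 : ℂ) * (u z * fderiv ℝ ψ z 1) + (1 / 2 * I) * (u z * fderiv ℝ ψ z I)) := by
        congr 1; ext z; simp only [dbar]; ring
    _ = (1 / 2 : ℂ) * (∫ z, u z * fderiv ℝ ψ z 1) + (1 / 2 * I) * ∫ z, u z * fderiv ℝ ψ z I := by
        rw [integral_add ((i1 1).const_mul _) ((i1 I).const_mul _), integral_const_mul,
          integral_const_mul]
    _ = -((1 / 2 : ℂ) * (∫ z, fderiv ℝ u z 1 * ψ z)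
          + (1 / 2 * I) * ∫ z, fderiv ℝ u z I * ψ z) := by rw [hp, hp]; ring
    _ = -∫ z, ((1 / 2 : ℂ) * (fderiv ℝ u z 1 * ψ z) + (1 / 2 * I) * (fderiv ℝ u z I * ψ z)) := by
        rw [integral_add ((i2 1).const_mul _) ((i2 I).const_mul _), integral_const_mul,
          integral_const_mul]
    _ = -∫ z, dbar u z * ψ z := by
        congr 2; ext z; simp only [dbar]; ring

/-! ### The Gaussian weight and local integrability -/

/-- The weight exponent `φ(z) = |z|²`. -/
noncomputable abbrev normSqWeight : ℂ → ℝ := fun z => ‖z‖ ^ 2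

/-- The density `e^{-2|z|²}`, as a complex-valued function. -/
noncomputable def gaussianWeight (z : ℂ) : ℂ := exp (-2 * (z * conj z))

theorem gaussianWeight_eq_ofReal (z : ℂ) :
    gaussianWeight z = (Real.exp (-2 * ‖z‖ ^ 2) : ℝ) := by
  rw [gaussianWeight, mul_conj, normSq_eq_norm_sq]; push_cast; rfl

theorem gaussianWeight_ne_zero (z : ℂ) : gaussianWeight z ≠ 0 := exp_ne_zero _

theorem conj_gaussianWeight (z : ℂ) : conj (gaussianWeight z) = gaussianWeight z := by
  rw [gaussianWeight_eq_ofReal, conj_ofReal]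

theorem contDiff_conj : ContDiff ℝ ∞ (fun z : ℂ => conj z) :=
  conjCLE.toContinuousLinearMap.contDiff

theorem ContDiff.conj {f : ℂ → ℂ} (hf : ContDiff ℝ ∞ f) : ContDiff ℝ ∞ fun z => conj (f z) :=
  contDiff_conj.comp hf

theorem contDiff_gaussianWeight : ContDiff ℝ ∞ gaussianWeight :=
  (contDiff_const.mul (contDiff_id.mul contDiff_conj)).cexp

theorem dbar_id (z : ℂ) : dbar (fun w => w) z = 0 :=
  dbar_eq_zero_of_differentiableAt differentiableAt_fun_id

theorem dbar_conj_id (z : ℂ) : dbar (fun w => conj w) z = 1 := by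
  rw [dbar_conj differentiableAt_fun_id]
  simp [wirtinger_eq_deriv (f := fun w => w) differentiableAt_fun_id]

theorem dbar_gaussianWeight (z : ℂ) :
    dbar gaussianWeight z = -2 * z * gaussianWeight z := by
  have hd : DifferentiableAt ℝ (fun w : ℂ => -2 * (w * conj w)) z :=
    (contDiff_const.mul (contDiff_id.mul contDiff_conj)).differentiable (n := ∞) (by simp) z
  have hc : DifferentiableAt ℝ (fun w : ℂ => conj w) z := contDiff_conj.differentiable (by simp) z
  have h1 : dbar (fun w : ℂ => -2 * (w * conj w)) z = -2 * z := by
    rw [dbar_const_mul _ (differentiableAt_fun_id.fun_mul hc), dbar_mul differentiableAt_fun_id hc,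
      dbar_id, dbar_conj_id]; ring
  have h2 : fderiv ℝ gaussianWeight z = _ := hd.hasFDerivAt.cexp.fderiv
  rw [← h1]
  simp only [dbar, h2, smul_apply, smul_eq_mul, gaussianWeight]
  ring

instance : IsLocallyFiniteMeasure (weightedMeasure normSqWeight) :=
  IsLocallyFiniteMeasure.withDensity_ofReal (by fun_prop)

theorem volume_absolutelyContinuous_weightedMeasure :
    (volume : Measure ℂ) ≪ weightedMeasure normSqWeight :=
  withDensity_absolutelyContinuous' (by fun_prop)
    (Filter.Eventually.of_forall fun z => by simp [Real.exp_pos])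

theorem integral_weightedMeasure (f : ℂ → ℂ) :
    ∫ z, f z ∂weightedMeasure normSqWeight = ∫ z, f z * gaussianWeight z := by
  unfold weightedMeasure
  rw [integral_withDensity_eq_integral_toReal_smul (by fun_prop)
    (Filter.Eventually.of_forall fun z => by simp)]
  refine integral_congr_ae (Filter.Eventually.of_forall fun z => ?_)
  simp only [gaussianWeight_eq_ofReal, ENNReal.toReal_ofReal (Real.exp_pos _).le, real_smul]
  ring

/-- The density is bounded below on compact sets; this makes Weyl's lemma applicable to elements of
L²_φ. -/
theorem WeightedL2.locallyIntegrable (f : WeightedL2 normSqWeight) :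
    LocallyIntegrable f (volume : Measure ℂ) := by
  have h1 : LocallyIntegrable f (weightedMeasure normSqWeight) :=
    (Lp.memLp f).locallyIntegrable (by norm_num)
  refine (locallyIntegrable_iff).2 fun K hK => ?_
  have h2 := h1.integrableOn_isCompact hK
  unfold IntegrableOn weightedMeasure at h2
  rw [restrict_withDensity hK.measurableSet,
    integrable_withDensity_iff_integrable_smul' (by fun_prop)
      (Filter.Eventually.of_forall fun z => by simp)] at h2
  -- Multiplying by the continuous function e^{2|z|²} undoes the density on the compact set.
  have h3 : IntegrableOn (fun z => Real.exp (2 * ‖z‖ ^ 2) •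
      ((ENNReal.ofReal (Real.exp (-2 * ‖z‖ ^ 2))).toReal • f z)) K :=
    IntegrableOn.continuousOn_smul h2 (by fun_prop) hK
  refine h3.congr_fun (fun z _ => ?_) hK.measurableSet
  simp only [ENNReal.toReal_ofReal (Real.exp_pos _).le, smul_smul, ← Real.exp_add]
  simp

/-! ### Test functions, the formal adjoint and the basic estimate -/

/-- The space `C_c^∞(ℂ)` of test functions. -/
def testFunctionSubmodule : Submodule ℂ (ℂ → ℂ) where
  carrier := {ψ | ContDiff ℝ ∞ ψ ∧ HasCompactSupport ψ}
  zero_mem' := ⟨contDiff_const, HasCompactSupport.zero⟩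
  add_mem' h k := ⟨h.1.add k.1, h.2.add k.2⟩
  smul_mem' c _ h := ⟨contDiff_const.smul h.1, h.2.smul_left (f := fun _ => c)⟩

/-- Smooth compactly supported functions on `ℂ`. -/
abbrev TestFn : Type := testFunctionSubmodule

namespace TestFn

theorem contDiff (ψ : TestFn) : ContDiff ℝ ∞ (ψ : ℂ → ℂ) := ψ.2.1

theorem hasCompactSupport (ψ : TestFn) : HasCompactSupport (ψ : ℂ → ℂ) := ψ.2.2

theorem differentiable (ψ : TestFn) : Differentiable ℝ (ψ : ℂ → ℂ) :=
  ψ.contDiff.differentiable (by simp)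

theorem memLp (ψ : TestFn) : MemLp (ψ : ℂ → ℂ) 2 (weightedMeasure normSqWeight) :=
  ψ.contDiff.continuous.memLp_of_hasCompactSupport ψ.hasCompactSupport

/-- The inclusion of the test functions into `L²_φ`. -/
noncomputable def toL2 : TestFn →ₗ[ℂ] WeightedL2 normSqWeight where
  toFun ψ := ψ.memLp.toLp
  map_add' _ _ := rfl
  map_smul' _ _ := rfl

theorem coeFn_toL2 (ψ : TestFn) :
    toL2 ψ =ᵐ[weightedMeasure normSqWeight] (ψ : ℂ → ℂ) := ψ.memLp.coeFn_toLp

theorem inner_toL2_left (ψ : TestFn) (u : WeightedL2 normSqWeight) :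
    inner ℂ (toL2 ψ) u = ∫ z, u z * (conj ((ψ : ℂ → ℂ) z) * gaussianWeight z) := by
  rw [L2.inner_def]
  have : ∫ z, inner ℂ (toL2 ψ z) (u z) ∂weightedMeasure normSqWeight
      = ∫ z, u z * conj ((ψ : ℂ → ℂ) z) ∂weightedMeasure normSqWeight := by
    refine integral_congr_ae ?_
    filter_upwards [ψ.coeFn_toL2] with z hz
    rw [hz, RCLike.inner_apply]
  rw [this, integral_weightedMeasure]
  simp only [mul_assoc]

theorem inner_toL2_toL2 (ψ χ : TestFn) :
    inner ℂ (toL2 ψ) (toL2 χ) =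
      ∫ z, (χ : ℂ → ℂ) z * (conj ((ψ : ℂ → ℂ) z) * gaussianWeight z) := by
  rw [inner_toL2_left]
  refine integral_congr_ae ?_
  filter_upwards [volume_absolutelyContinuous_weightedMeasure.ae_le χ.coeFn_toL2] with z hz
  rw [hz]

/-- The derivative `∂̄` on test functions. -/
noncomputable def dbarTest (ψ : TestFn) : TestFn :=
  ⟨dbar ψ, ψ.contDiff.dbar, ψ.hasCompactSupport.dbar⟩

/-- The formal adjoint `∂̄*ψ = -∂ψ + 2 z̄ ψ` of `∂̄` with respect to the weight `e^{-2|z|²}`. -/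
noncomputable def dbarAdjoint : TestFn →ₗ[ℂ] TestFn where
  toFun ψ := ⟨fun z => 2 * (conj z * (ψ : ℂ → ℂ) z) + (-1) * wirtinger ψ z,
    (contDiff_const.mul (contDiff_conj.mul ψ.contDiff)).add (contDiff_const.mul ψ.contDiff.wirtinger),
    (ψ.hasCompactSupport.mul_left.mul_left).add ψ.hasCompactSupport.wirtinger.mul_left⟩
  map_add' ψ χ := by
    ext z
    have := wirtinger_add (ψ.differentiable z) (χ.differentiable z)
    change 2 * (conj z * ((ψ : ℂ → ℂ) z + (χ : ℂ → ℂ) z)) +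
      (-1) * wirtinger (fun w => (ψ : ℂ → ℂ) w + (χ : ℂ → ℂ) w) z =
      (2 * (conj z * (ψ : ℂ → ℂ) z) + (-1) * wirtinger ψ z) +
      (2 * (conj z * (χ : ℂ → ℂ) z) + (-1) * wirtinger χ z)
    rw [this]; ring
  map_smul' c ψ := by
    ext z
    have := wirtinger_const_mul c (ψ.differentiable z)
    change 2 * (conj z * (c * (ψ : ℂ → ℂ) z)) + (-1) * wirtinger (fun w => c * (ψ : ℂ → ℂ) w) z =
      c * (2 * (conj z * (ψ : ℂ → ℂ) z) + (-1) * wirtinger ψ z)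
    rw [this]; ring

theorem dbarAdjoint_apply (ψ : TestFn) (z : ℂ) : (dbarAdjoint ψ : ℂ → ℂ) z =
    2 * (conj z * (ψ : ℂ → ℂ) z) + (-1) * wirtinger ψ z := rfl

/-- The product rule behind the formula for ∂̄*: the term 2 z̄ ψ comes from differentiating the
weight. -/
theorem dbar_conj_mul_gaussianWeight (ψ : TestFn) (z : ℂ) :
    dbar (fun w => conj ((ψ : ℂ → ℂ) w) * gaussianWeight w) z =
      -(conj ((dbarAdjoint ψ : ℂ → ℂ) z) * gaussianWeight z) := by
  rw [dbar_mul (ψ.contDiff.conj.differentiable (by simp) z)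
    (contDiff_gaussianWeight.differentiable (by simp) z), dbar_conj (ψ.differentiable z),
    dbar_gaussianWeight, dbarAdjoint_apply]
  simp only [map_add, map_mul, map_neg, map_one, conj_conj, Complex.conj_ofNat]
  ring

theorem contDiff_conj_mul_gaussianWeight (ψ : TestFn) :
    ContDiff ℝ ∞ fun z => conj ((ψ : ℂ → ℂ) z) * gaussianWeight z :=
  ψ.contDiff.conj.mul contDiff_gaussianWeight

theorem hasCompactSupport_conj_mul_gaussianWeight (ψ : TestFn) :
    HasCompactSupport fun z => conj ((ψ : ℂ → ℂ) z) * gaussianWeight z :=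
  (ψ.hasCompactSupport.comp_left (g := fun w => conj w) (map_zero _)).mul_right

/-- `∂̄ u = f` weakly if and only if `⟨∂̄*ψ, u⟩ = ⟨ψ, f⟩` for all test functions `ψ`. -/
theorem _root_.isWeakDbar_iff_inner (u f : WeightedL2 normSqWeight) :
    IsWeakDbar u f ↔ ∀ ψ : TestFn,
      inner ℂ (toL2 (dbarAdjoint ψ)) u = inner ℂ (toL2 ψ) f := by
  have key : ∀ ψ : TestFn, inner ℂ (toL2 (dbarAdjoint ψ)) u =
      -∫ z, u z * dbar (fun w => conj ((ψ : ℂ → ℂ) w) * gaussianWeight w) z := by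
    intro ψ
    rw [inner_toL2_left, ← integral_neg]
    congr 1; ext z
    rw [dbar_conj_mul_gaussianWeight]; ring
  constructor
  · intro h ψ
    rw [key, h _ ψ.contDiff_conj_mul_gaussianWeight ψ.hasCompactSupport_conj_mul_gaussianWeight,
      neg_neg, inner_toL2_left]
  · intro h χ hχ hc
    -- The weight is smooth and nowhere zero, so every test function χ has the form ψ̄ e^{-2|z|²}.
    let ψ : TestFn := ⟨fun z => conj (χ z) * (gaussianWeight z)⁻¹,
      hχ.conj.mul (contDiff_gaussianWeight.inv gaussianWeight_ne_zero),
      (hc.comp_left (g := fun w => conj w) (map_zero _)).mul_right⟩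
    have hψ : (fun w => conj ((ψ : ℂ → ℂ) w) * gaussianWeight w) = χ := by
      ext w
      change conj (conj (χ w) * (gaussianWeight w)⁻¹) * gaussianWeight w = χ w
      rw [map_mul, conj_conj, map_inv₀, conj_gaussianWeight, mul_assoc,
        inv_mul_cancel₀ (gaussianWeight_ne_zero w), mul_one]
    have h1 := h ψ
    have h2 := inner_toL2_left ψ f
    rw [key, hψ] at h1
    rw [← h1] at h2
    rw [eq_neg_iff_add_eq_zero, ← neg_eq_iff_add_eq_zero, h2]
    congr 1; ext z
    rw [← congrFun hψ z]

theorem inner_dbarAdjoint_left (ψ χ : TestFn) :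
    inner ℂ (toL2 (dbarAdjoint ψ)) (toL2 χ) = inner ℂ (toL2 ψ) (toL2 (dbarTest χ)) := by
  have h := isWeakDbar_dbar χ.contDiff _ ψ.contDiff_conj_mul_gaussianWeight
    ψ.hasCompactSupport_conj_mul_gaussianWeight
  rw [inner_toL2_toL2, inner_toL2_toL2]
  change _ = ∫ z, dbar χ z * _
  rw [← neg_eq_iff_eq_neg.2 h, ← integral_neg]
  congr 1; ext z
  rw [dbar_conj_mul_gaussianWeight]; ring

/-- The commutator is the constant 2 = 2 ∂²φ/∂z∂z̄: only the derivative of 2 z̄ survives. -/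
theorem dbarTest_dbarAdjoint (ψ : TestFn) :
    dbarTest (dbarAdjoint ψ) = dbarAdjoint (dbarTest ψ) + (2 : ℂ) • ψ := by
  ext z
  have hc : DifferentiableAt ℝ (fun w : ℂ => conj w) z := contDiff_conj.differentiable (by simp) z
  have hw : DifferentiableAt ℝ (wirtinger ψ) z := ψ.contDiff.wirtinger.differentiable (by simp) z
  change dbar (fun w => 2 * (conj w * (ψ : ℂ → ℂ) w) + (-1) * wirtinger ψ w) z =
    (2 * (conj z * dbar ψ z) + (-1) * wirtinger (dbar ψ) z) + 2 * (ψ : ℂ → ℂ) z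
  rw [dbar_add ((hc.fun_mul (ψ.differentiable z)).const_mul 2) (hw.const_mul _),
    dbar_const_mul _ (hc.fun_mul (ψ.differentiable z)), dbar_const_mul _ hw,
    dbar_mul hc (ψ.differentiable z), dbar_conj_id, dbar_wirtinger_comm ψ.contDiff]
  ring

/-- The basic estimate `2 ‖ψ‖² ≤ ‖∂̄*ψ‖²`. -/
theorem two_mul_norm_sq_le (ψ : TestFn) :
    2 * ‖toL2 ψ‖ ^ 2 ≤ ‖toL2 (dbarAdjoint ψ)‖ ^ 2 := by
  have h : (‖toL2 (dbarAdjoint ψ)‖ : ℂ) ^ 2 =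
      (‖toL2 (dbarTest ψ)‖ : ℂ) ^ 2 + 2 * (‖toL2 ψ‖ : ℂ) ^ 2 := by
    have e := fun x : WeightedL2 normSqWeight => inner_self_eq_norm_sq_to_K (𝕜 := ℂ) x
    simp only [coe_algebraMap] at e
    -- ‖∂̄*ψ‖² = ⟨ψ, ∂̄∂̄*ψ⟩ = ⟨ψ, ∂̄*∂̄ψ⟩ + 2‖ψ‖², and ⟨ψ, ∂̄*∂̄ψ⟩ = ‖∂̄ψ‖².
    rw [← e, ← e, ← e, inner_dbarAdjoint_left, dbarTest_dbarAdjoint, map_add, map_smul,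
      inner_add_right, inner_smul_right, ← inner_conj_symm, inner_dbarAdjoint_left,
      inner_conj_symm]
  have h' : ‖toL2 (dbarAdjoint ψ)‖ ^ 2 = ‖toL2 (dbarTest ψ)‖ ^ 2 + 2 * ‖toL2 ψ‖ ^ 2 := by
    exact_mod_cast h
  nlinarith [sq_nonneg ‖toL2 (dbarTest ψ)‖]

/-- A weaker constant than 1/√2 suffices; the explicit factor 1 is the bound passed to
`LinearMap.extendOfNorm_eq`. -/
theorem norm_toL2_le (ψ : TestFn) : ‖toL2 ψ‖ ≤ 1 * ‖toL2 (dbarAdjoint ψ)‖ := by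
  have h := ψ.two_mul_norm_sq_le
  rw [one_mul]
  exact (pow_le_pow_iff_left₀ (norm_nonneg _) (norm_nonneg _) two_ne_zero).1 (by nlinarith [sq_nonneg ‖toL2 ψ‖])

/-- The range of `∂̄*` is orthogonal to the entire functions. -/
theorem inner_dbarAdjoint_entireL2 (ψ : TestFn) {h : WeightedL2 normSqWeight}
    (hh : h ∈ entireL2 normSqWeight) : inner ℂ (toL2 (dbarAdjoint ψ)) h = 0 := by
  obtain ⟨g, hg, hhg⟩ := hh
  have h1 := isWeakDbar_dbar (hg.contDiff.restrict_scalars ℝ) _ ψ.contDiff_conj_mul_gaussianWeight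
    ψ.hasCompactSupport_conj_mul_gaussianWeight
  rw [inner_toL2_left]
  have h2 : ∫ z, h z * (conj ((dbarAdjoint ψ : ℂ → ℂ) z) * gaussianWeight z) =
      -∫ z, g z * dbar (fun w => conj ((ψ : ℂ → ℂ) w) * gaussianWeight w) z := by
    rw [← integral_neg]
    refine integral_congr_ae ?_
    filter_upwards [volume_absolutelyContinuous_weightedMeasure.ae_le hhg] with z hz
    rw [hz, dbar_conj_mul_gaussianWeight]; ring
  rw [h2, h1]
  simp [dbar_eq_zero_of_differentiableAt (hg _)]

end TestFn

/-! ### Weyl's lemma -/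

/-- If `u` is locally integrable with `∂̄u = 0` weakly, its convolution with a test function is
entire. -/
theorem differentiable_integral_mul_sub {u g : ℂ → ℂ} (hu : LocallyIntegrable u)
    (h : IsWeakDbar u 0) (hg : ContDiff ℝ ∞ g) (hc : HasCompactSupport g) :
    Differentiable ℂ fun x => ∫ z, u z * g (x - z) := by
  intro x
  have hder := hc.hasFDerivAt_convolution_right (ContinuousLinearMap.mul ℝ ℂ) hu
    (hg.of_le (by simp)) x
  have hconv : (fun x => ∫ z, u z * g (x - z)) =
      convolution u g (ContinuousLinearMap.mul ℝ ℂ) volume := rfl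
  rw [hconv]
  refine differentiableAt_of_dbar_eq_zero hder.differentiableAt ?_
  have hcg : Continuous (fderiv ℝ g) := hg.continuous_fderiv (by simp)
  have hex := (hc.fderiv (𝕜 := ℝ)).convolutionExists_right
    ((ContinuousLinearMap.mul ℝ ℂ).precompR ℂ) hu hcg x
  have hval : ∀ v, fderiv ℝ (convolution u g (ContinuousLinearMap.mul ℝ ℂ) volume) x v =
      ∫ z, u z * fderiv ℝ g (x - z) v := by
    intro v
    rw [hder.fderiv, convolution, ContinuousLinearMap.integral_apply hex]
    rfl
  have hint : ∀ v, Integrable fun z => u z * fderiv ℝ g (x - z) v := fun v =>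
    (ContinuousLinearMap.integrable_comp (ContinuousLinearMap.apply ℝ ℂ v) hex :)
  have hψ : ContDiff ℝ ∞ fun z => g (x - z) := hg.comp (contDiff_const.sub contDiff_id)
  have hψc : HasCompactSupport fun z => g (x - z) :=
    hc.comp_homeomorph (Homeomorph.subLeft x)
  have hfd : ∀ z v, fderiv ℝ (fun z => g (x - z)) z v = -fderiv ℝ g (x - z) v := by
    intro z v
    have h1 : HasFDerivAt (fun z : ℂ => x - z) (-ContinuousLinearMap.id ℝ ℂ) z :=
      (hasFDerivAt_id z).const_sub x
    have h2 := ((hg.differentiable (by simp) (x - z)).hasFDerivAt.comp z h1).fderiv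
    have h3 : fderiv ℝ (fun z => g (x - z)) z = _ := h2
    rw [h3]; simp
  -- Up to sign, ∂̄ of the convolution at x is the weak pairing of u with the test function z ↦ g(x
  -- - z).
  have h0 := h _ hψ hψc
  simp only [dbar, hfd, Pi.zero_apply, zero_mul, integral_zero, neg_zero] at h0
  rw [dbar, hval, hval, ← integral_const_mul, ← integral_add (hint 1) ((hint I).const_mul I),
    ← integral_const_mul, ← neg_eq_zero, ← integral_neg, ← h0]
  congr 1; ext z; ring

theorem integral_mul_integral_mul_sub_swap {u a b : ℂ → ℂ} (hu : LocallyIntegrable u)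
    (ha : Continuous a) (ha' : HasCompactSupport a) (hb : Continuous b)
    (hb' : HasCompactSupport b) :
    ∫ x, a x * ∫ z, u z * b (x - z) = ∫ z, u z * ∫ x, a x * b (x - z) := by
  -- Only z in supp a - supp b contribute, so u can be truncated to this compact set to become
  -- integrable for Fubini.
  let K : Set ℂ := (fun p : ℂ × ℂ => p.1 - p.2) '' (tsupport a ×ˢ tsupport b)
  have hK : IsCompact K := (IsCompact.prod ha' hb').image (by fun_prop)
  have hu1 : Integrable (K.indicator u) :=
    (hu.integrableOn_isCompact hK).integrable_indicator hK.measurableSet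
  have ha1 : Integrable a := ha.integrable_of_hasCompactSupport ha'
  have key : ∀ x z, a x * (u z * b (x - z)) = b (x - z) * (a x * K.indicator u z) := by
    intro x z
    by_cases hz : z ∈ K
    · rw [indicator_of_mem hz]; ring
    · have : a x = 0 ∨ b (x - z) = 0 := by
        by_contra! hne
        exact hz ⟨(x, x - z), ⟨subset_tsupport _ hne.1, subset_tsupport _ hne.2⟩, by simp⟩
      rcases this with h | h <;> simp [h]
  obtain ⟨C, hC⟩ := hb.bounded_above_of_compact_support hb'
  have hint : Integrable (fun p : ℂ × ℂ => b (p.1 - p.2) * (a p.1 * K.indicator u p.2))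
      (volume.prod volume) :=
    (ha1.mul_prod hu1).bdd_mul (hb.comp (by fun_prop)).aestronglyMeasurable
      (Filter.Eventually.of_forall fun p => hC _)
  calc ∫ x, a x * ∫ z, u z * b (x - z)
      = ∫ x, ∫ z, b (x - z) * (a x * K.indicator u z) := by
        congr 1; ext x; rw [← integral_const_mul]; simp only [key]
    _ = ∫ z, ∫ x, b (x - z) * (a x * K.indicator u z) := integral_integral_swap hint
    _ = ∫ z, u z * ∫ x, a x * b (x - z) := by
        congr 1; ext z; rw [← integral_const_mul]
        congr 1; ext x; rw [← key]; ring

/-- The mean value property of entire functions against a radial density. -/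
theorem integral_radial_mul {ρ v : ℂ → ℂ} (hρ : Continuous ρ) (hc : HasCompactSupport ρ)
    (hrad : ∀ z w : ℂ, ‖z‖ = ‖w‖ → ρ z = ρ w) (hv : Differentiable ℂ v) :
    ∫ t, ρ t * v t = v 0 * ∫ t, ρ t := by
  -- Rotations preserve area and ρ. Averaging over θ therefore replaces v(t) by its mean over the
  -- circle of radius |t|, which is v(0).
  have hrot : ∀ θ : ℝ, ∫ t, ρ t * v (t * circleMap 0 1 θ) = ∫ t, ρ t * v t := by
    intro θ
    have hn : ‖circleMap 0 1 θ‖ = 1 := by simp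
    let c : Circle := ⟨circleMap 0 1 θ, by simp [Submonoid.unitSphere]⟩
    have hm := (rotation c).measurePreserving
    rw [← hm.integral_comp (rotation c).toHomeomorph.measurableEmbedding
      (fun t => ρ t * v t)]
    congr 1; ext t
    have h1 : rotation c t = t * circleMap 0 1 θ := by rw [rotation_apply, mul_comm]
    rw [h1, hrad (t * circleMap 0 1 θ) t (by rw [norm_mul, hn, mul_one])]
  have hcont : Continuous fun p : ℝ × ℂ => ρ p.2 * v (p.2 * circleMap 0 1 p.1) :=
    (hρ.comp continuous_snd).mul (hv.continuous.comp
      (continuous_snd.mul ((continuous_circleMap 0 1).comp continuous_fst)))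
  have hint : Integrable (fun p : ℝ × ℂ => ρ p.2 * v (p.2 * circleMap 0 1 p.1))
      ((volume.restrict (Ioc 0 (2 * Real.pi))).prod volume) := by
    rw [← Measure.restrict_univ (μ := (volume : Measure ℂ)), Measure.prod_restrict]
    have h1 : IntegrableOn (fun p : ℝ × ℂ => ρ p.2 * v (p.2 * circleMap 0 1 p.1))
        (Icc 0 (2 * Real.pi) ×ˢ tsupport ρ) (volume.prod volume) :=
      hcont.continuousOn.integrableOn_compact (isCompact_Icc.prod hc.isCompact)
    refine IntegrableOn.of_forall_sdiff_eq_zero h1 (measurableSet_Ioc.prod MeasurableSet.univ) ?_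
    rintro ⟨θ, t⟩ ⟨⟨hθ, -⟩, hn⟩
    have : t ∉ tsupport ρ := fun ht => hn ⟨Ioc_subset_Icc_self hθ, ht⟩
    simp [image_eq_zero_of_notMem_tsupport this]
  have hswap := integral_integral_swap
    (f := fun (θ : ℝ) (t : ℂ) => ρ t * v (t * circleMap 0 1 θ)) hint
  simp only [hrot] at hswap
  have hmean : ∀ t, ∫ θ in Ioc 0 (2 * Real.pi), ρ t * v (t * circleMap 0 1 θ) =
      (2 * Real.pi : ℝ) * (ρ t * v 0) := by
    intro t
    have hd : Differentiable ℂ fun w => v (t * w) := hv.comp (differentiable_id.const_mul t)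
    have h1 := (hd.diffContOnCl (s := Metric.ball 0 |1|)).circleAverage
    rw [Real.circleAverage_def, intervalIntegral.integral_of_le Real.two_pi_pos.le, mul_zero,
      inv_smul_eq_iff₀ Real.two_pi_pos.ne', real_smul] at h1
    rw [integral_const_mul, h1]; ring
  simp only [hmean] at hswap
  rw [setIntegral_const, integral_const_mul, integral_mul_const, real_smul] at hswap
  have h2 : (volume.real (Ioc 0 (2 * Real.pi))) = 2 * Real.pi := by
    simp [Measure.real, Real.volume_Ioc, Real.pi_pos.le]
  rw [h2] at hswap
  rw [mul_left_cancel₀ (by exact_mod_cast Real.two_pi_pos.ne') hswap, mul_comm]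

theorem exists_radial_mollifier : ∃ ρ : ℂ → ℂ, ContDiff ℝ ∞ ρ ∧ HasCompactSupport ρ ∧
    (∀ z w : ℂ, ‖z‖ = ‖w‖ → ρ z = ρ w) ∧ ∫ z, ρ z = 1 := by
  let b : ContDiffBump (0 : ℝ) := ⟨1, 2, one_pos, one_lt_two⟩
  -- The squared norm keeps the radial function smooth at the origin.
  let r : ℂ → ℝ := fun z => b (‖z‖ ^ 2)
  have hr : ContDiff ℝ ∞ r := b.contDiff.comp (contDiff_norm_sq ℝ)
  have hrc : HasCompactSupport r := by
    refine HasCompactSupport.of_support_subset_isCompact (isCompact_closedBall 0 2) fun z hz => ?_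
    rw [mem_closedBall_zero_iff]
    have hz' : ‖z‖ ^ 2 ∈ Function.support b := hz
    rw [b.support_eq, mem_ball_zero_iff, Real.norm_of_nonneg (sq_nonneg _)] at hz'
    change ‖z‖ ^ 2 < 2 at hz'
    nlinarith [norm_nonneg z]
  have hpos : 0 < ∫ z, r z := by
    refine hr.continuous.integral_pos_of_hasCompactSupport_nonneg_nonzero hrc
      (fun z => b.nonneg) (x := 0) ?_
    have : r 0 = 1 := by
      have := b.one_of_mem_closedBall (x := 0) (Metric.mem_closedBall_self b.rIn_pos.le)
      simpa [r] using this
    rw [this]; exact one_ne_zero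
  refine ⟨fun z => ((∫ z, r z : ℝ) : ℂ)⁻¹ * (r z : ℂ),
    contDiff_const.mul (ofRealCLM.contDiff.comp hr),
    (hrc.comp_left (g := ((↑) : ℝ → ℂ)) ofReal_zero).mul_left, ?_, ?_⟩
  · intro z w h
    simp only [r, h]
  · rw [integral_const_mul, integral_complex_ofReal]
    exact inv_mul_cancel₀ (by exact_mod_cast hpos.ne')

/-- **Weyl's lemma** for `∂̄`: a locally integrable function with `∂̄u = 0` in the sense of
distributions agrees almost everywhere with an entire function. -/
theorem IsWeakDbar.exists_differentiable_ae_eq {u : ℂ → ℂ} (hu : LocallyIntegrable u)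
    (h : IsWeakDbar u 0) : ∃ g : ℂ → ℂ, Differentiable ℂ g ∧ u =ᵐ[volume] g := by
  obtain ⟨ρ, hρ, hρc, hrad, hone⟩ := exists_radial_mollifier
  have hG := differentiable_integral_mul_sub hu h hρ hρc
  refine ⟨_, hG, ?_⟩
  refine ae_eq_of_integral_contDiff_smul_eq hu hG.continuous.locallyIntegrable fun ψ hψ hψc => ?_
  -- Let v(x) = ∫ u(z) ψ(z - x) dz, which is entire. The mean value property gives ∫ ρ v = v(0) = ∫
  -- u ψ, while Fubini turns ∫ ρ v into ∫ ψ (u ∗ ρ). Hence u = u ∗ ρ for this one mollifier, with no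
  -- limit taken.
  let g : ℂ → ℂ := fun z => ψ (-z)
  have hg : ContDiff ℝ ∞ g := ofRealCLM.contDiff.comp (hψ.comp contDiff_neg)
  have hgc : HasCompactSupport g :=
    (hψc.comp_homeomorph (Homeomorph.neg ℂ)).comp_left (g := ((↑) : ℝ → ℂ)) ofReal_zero
  have hv := differentiable_integral_mul_sub hu h hg hgc
  have hmean := integral_radial_mul hρ.continuous hρc hrad hv
  rw [hone, mul_one, integral_mul_integral_mul_sub_swap hu hρ.continuous hρc hg.continuous hgc]
    at hmean
  have hψ' : Continuous fun z => (ψ z : ℂ) := continuous_ofReal.comp hψ.continuous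
  have hψc' : HasCompactSupport fun z => (ψ z : ℂ) :=
    hψc.comp_left (g := ((↑) : ℝ → ℂ)) ofReal_zero
  simp only [real_smul]
  rw [integral_mul_integral_mul_sub_swap hu hψ' hψc' hρ.continuous hρc]
  have hinner : ∀ z, ∫ x, (ψ x : ℂ) * ρ (x - z) = ∫ x, ρ x * g (x - z) := by
    intro z
    -- Substitute z - x for x and use ρ(-x) = ρ(x).
    rw [← integral_sub_left_eq_self (fun x => (ψ x : ℂ) * ρ (x - z)) volume z]
    congr 1; ext x
    rw [hrad (z - x - z) x (by rw [sub_sub_cancel_left, norm_neg]), mul_comm]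
    simp only [g, neg_sub]
  simp only [hinner, hmean]
  congr 1; ext z
  simp only [g, zero_sub, neg_neg, mul_comm]

/-! ### Existence of the canonical solution operator -/

namespace TestFn

/-- The closure of the range of `∂̄*` in `L²_φ`. -/
noncomputable def closureRangeDbarAdjoint : Submodule ℂ (WeightedL2 normSqWeight) :=
  (LinearMap.range (toL2 ∘ₗ dbarAdjoint)).topologicalClosure

instance : CompleteSpace closureRangeDbarAdjoint :=
  (Submodule.isClosed_topologicalClosure _).completeSpace_coe

/-- `∂̄*` as a map into the closure of its range. -/
noncomputable def toClosureRange : TestFn →ₗ[ℂ] closureRangeDbarAdjoint :=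
  (toL2 ∘ₗ dbarAdjoint).codRestrict _ fun ψ =>
    Submodule.le_topologicalClosure _ (LinearMap.mem_range_self _ ψ)

theorem coe_toClosureRange (ψ : TestFn) :
    (toClosureRange ψ : WeightedL2 normSqWeight) = toL2 (dbarAdjoint ψ) := rfl

theorem denseRange_toClosureRange : DenseRange toClosureRange := by
  rintro ⟨x, hx⟩
  rw [closure_subtype]
  refine closure_mono ?_ hx
  rintro _ ⟨ψ, rfl⟩
  exact ⟨toClosureRange ψ, mem_range_self ψ, rfl⟩

/-- The bounded left inverse of `∂̄*` on the closure of its range. -/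
noncomputable def dbarAdjointInv : closureRangeDbarAdjoint →L[ℂ] WeightedL2 normSqWeight :=
  toL2.extendOfNorm toClosureRange

theorem dbarAdjointInv_toClosureRange (ψ : TestFn) :
    dbarAdjointInv (toClosureRange ψ) = toL2 ψ :=
  LinearMap.extendOfNorm_eq denseRange_toClosureRange ⟨1, norm_toL2_le⟩ ψ

/-- The canonical solution operator to `∂̄`, as the adjoint of the left inverse of `∂̄*`. -/
noncomputable def canonicalSolution :
    WeightedL2 normSqWeight →L[ℂ] WeightedL2 normSqWeight :=
  ContinuousLinearMap.adjoint
    (dbarAdjointInv ∘L closureRangeDbarAdjoint.orthogonalProjectionOnto)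

/-- If T is the projection followed by the left inverse, then ⟨∂̄*ψ, T*f⟩ = ⟨T∂̄*ψ, f⟩ = ⟨ψ, f⟩.
Moreover T vanishes on A²_φ, which is orthogonal to the range of ∂̄*, so T*f ⊥ A²_φ. -/
theorem isCanonicalSolutionOperator_canonicalSolution :
    IsCanonicalSolutionOperator normSqWeight canonicalSolution := by
  intro f
  refine ⟨(isWeakDbar_iff_inner _ _).2 fun ψ => ?_, ?_⟩
  · rw [canonicalSolution, ContinuousLinearMap.adjoint_inner_right,
      ContinuousLinearMap.comp_apply, ← coe_toClosureRange,
      Submodule.orthogonalProjectionOnto_mem_subspace_eq_self, dbarAdjointInv_toClosureRange]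
  · intro h hh
    have h0 : h ∈ closureRangeDbarAdjointᗮ := by
      rw [closureRangeDbarAdjoint, Submodule.orthogonal_closure]
      rintro _ ⟨ψ, rfl⟩
      exact ψ.inner_dbarAdjoint_entireL2 hh
    rw [canonicalSolution, ContinuousLinearMap.adjoint_inner_right,
      ContinuousLinearMap.comp_apply,
      Submodule.orthogonalProjectionOnto_apply_of_mem_orthogonal h0, map_zero,
      inner_zero_left]

end TestFn

/-! ### Uniqueness -/

theorem mem_entireL2_of_isWeakDbar_zero {u : WeightedL2 normSqWeight}
    (h : IsWeakDbar u (0 : WeightedL2 normSqWeight)) : u ∈ entireL2 normSqWeight := by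
  have h' : IsWeakDbar u 0 := by
    intro ψ hψ hc
    rw [h ψ hψ hc]
    congr 1
    refine integral_congr_ae ?_
    filter_upwards [volume_absolutelyContinuous_weightedMeasure.ae_le
      (Lp.coeFn_zero ℂ 2 (weightedMeasure normSqWeight))] with z hz
    rw [hz]
  obtain ⟨g, hg, hug⟩ := h'.exists_differentiable_ae_eq (WeightedL2.locallyIntegrable u)
  exact ⟨g, hg, (withDensity_absolutelyContinuous _ _).ae_le hug⟩

theorem IsCanonicalSolutionOperator.eq
    {S S' : WeightedL2 normSqWeight →L[ℂ] WeightedL2 normSqWeight}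
    (hS : IsCanonicalSolutionOperator normSqWeight S)
    (hS' : IsCanonicalSolutionOperator normSqWeight S') : S = S' := by
  ext1 f
  have h1 : S f - S' f ∈ entireL2 normSqWeight := by
    refine mem_entireL2_of_isWeakDbar_zero ((isWeakDbar_iff_inner _ _).2 fun ψ => ?_)
    rw [inner_sub_right, (isWeakDbar_iff_inner _ _).1 (hS f).1 ψ,
      (isWeakDbar_iff_inner _ _).1 (hS' f).1 ψ, sub_self, inner_zero_right]
  have h2 : S f - S' f ∈ (entireL2 normSqWeight)ᗮ := Submodule.sub_mem _ (hS f).2 (hS' f).2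
  exact sub_eq_zero.1 (inner_self_eq_zero.1 (h2 _ h1))

/-! ### Weighted translations -/

namespace TestFn

theorem contDiff_cexp_translate (a : ℂ) :
    ContDiff ℝ ∞ fun z : ℂ => exp (2 * conj a * z - conj a * a) :=
  ((contDiff_const.mul contDiff_id).sub contDiff_const).cexp

/-- The weighted translation `ψ ↦ ψ(z - a) e^{2 ā z - |a|²}`, an isometry for the weight
`e^{-2|z|²}`. -/
noncomputable def translate (a : ℂ) (ψ : TestFn) : TestFn :=
  ⟨fun z => (ψ : ℂ → ℂ) (z - a) * exp (2 * conj a * z - conj a * a),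
    (ψ.contDiff.comp (contDiff_id.sub contDiff_const)).mul (contDiff_cexp_translate a),
    (ψ.hasCompactSupport.comp_homeomorph (Homeomorph.subRight a)).mul_right⟩

theorem translate_apply (a : ℂ) (ψ : TestFn) (z : ℂ) : (translate a ψ : ℂ → ℂ) z =
    (ψ : ℂ → ℂ) (z - a) * exp (2 * conj a * z - conj a * a) := rfl

/-- Expanding |z - a|² shows that translation changes the weight by the squared modulus of a
holomorphic factor, which `translate` absorbs. -/
theorem gaussianWeight_sub (a z : ℂ) :
    gaussianWeight (z - a) = exp (2 * conj a * z - conj a * a) *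
      (conj (exp (2 * conj a * z - conj a * a)) * gaussianWeight z) := by
  simp only [gaussianWeight, ← exp_conj, ← exp_add, map_sub, map_mul, conj_conj,
    Complex.conj_ofNat]
  congr 1; ring

theorem inner_translate (a : ℂ) (ψ χ : TestFn) :
    inner ℂ (toL2 (translate a ψ)) (toL2 (translate a χ)) = inner ℂ (toL2 ψ) (toL2 χ) := by
  rw [inner_toL2_toL2, inner_toL2_toL2, ← integral_sub_right_eq_self
    (fun z => (χ : ℂ → ℂ) z * (conj ((ψ : ℂ → ℂ) z) * gaussianWeight z)) a]
  congr 1; ext z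
  simp only [translate_apply, gaussianWeight_sub, map_mul]
  ring

theorem norm_translate (a : ℂ) (ψ : TestFn) : ‖toL2 (translate a ψ)‖ = ‖toL2 ψ‖ := by
  rw [@norm_eq_sqrt_re_inner ℂ, @norm_eq_sqrt_re_inner ℂ, inner_translate]

/-- Differentiating the exponential contributes -2ā, which turns 2 z̄ into twice the conjugate of z
- a. -/
theorem dbarAdjoint_translate (a : ℂ) (ψ : TestFn) :
    dbarAdjoint (translate a ψ) = translate a (dbarAdjoint ψ) := by
  ext z
  rw [translate_apply, dbarAdjoint_apply, dbarAdjoint_apply, translate_apply]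
  have hE : HasDerivAt (fun z : ℂ => exp (2 * conj a * z - conj a * a))
      (exp (2 * conj a * z - conj a * a) * (2 * conj a * 1)) z :=
    (((hasDerivAt_id z).const_mul (2 * conj a)).sub_const _).cexp
  have h1 : wirtinger (fun z => (ψ : ℂ → ℂ) (z - a)) z = wirtinger ψ (z - a) := by
    simp only [wirtinger, fderiv_comp_sub]
  have h2 : DifferentiableAt ℝ (fun z => (ψ : ℂ → ℂ) (z - a)) z :=
    (ψ.differentiable (z - a)).comp z (differentiableAt_id.sub_const a)
  change 2 * _ + (-1) * wirtinger
    (fun z => (ψ : ℂ → ℂ) (z - a) * exp (2 * conj a * z - conj a * a)) z = _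
  rw [wirtinger_mul h2 (hE.differentiableAt.restrictScalars ℝ),
    wirtinger_eq_deriv hE.differentiableAt, hE.deriv, h1, map_sub]
  ring

theorem inner_translate_eq_zero {ψ : TestFn}
    (hψ : Function.support (ψ : ℂ → ℂ) ⊆ Metric.ball 0 1) {a b : ℂ} (hab : 2 ≤ ‖a - b‖) :
    inner ℂ (toL2 (translate a ψ)) (toL2 (translate b ψ)) = 0 := by
  rw [inner_toL2_toL2]
  refine integral_eq_zero_of_ae (Filter.Eventually.of_forall fun z => ?_)
  by_cases ha : (ψ : ℂ → ℂ) (z - a) = 0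
  · simp [translate_apply, ha]
  by_cases hb : (ψ : ℂ → ℂ) (z - b) = 0
  · simp [translate_apply, hb]
  have ha' := mem_ball_zero_iff.1 (hψ ha)
  have hb' := mem_ball_zero_iff.1 (hψ hb)
  have := norm_sub_le (z - b) (z - a)
  rw [sub_sub_sub_cancel_left] at this
  linarith

theorem exists_support_subset_ball : ∃ ψ : TestFn,
    Function.support (ψ : ℂ → ℂ) ⊆ Metric.ball 0 1 ∧ toL2 ψ ≠ 0 := by
  let b : ContDiffBump (0 : ℂ) := ⟨1 / 2, 1, by norm_num, by norm_num⟩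
  let ψ : TestFn := ⟨fun z => (b z : ℂ), ofRealCLM.contDiff.comp b.contDiff,
    b.hasCompactSupport.comp_left (g := ((↑) : ℝ → ℂ)) ofReal_zero⟩
  refine ⟨ψ, fun z hz => ?_, fun h0 => ?_⟩
  · rw [← b.support_eq]
    exact fun hb : b z = 0 => hz (by change ((b z : ℝ) : ℂ) = 0; rw [hb, ofReal_zero])
  · have h1 : (ψ : ℂ → ℂ) =ᵐ[volume] fun _ => 0 := by
      refine volume_absolutelyContinuous_weightedMeasure.ae_le ?_
      have h2 := ψ.coeFn_toL2
      rw [h0] at h2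
      exact h2.symm.trans (Lp.coeFn_zero ℂ 2 (weightedMeasure normSqWeight))
    have h2 := congrFun ((ψ.contDiff.continuous.ae_eq_iff_eq volume continuous_const).1 h1) 0
    have h3 : b 0 = 1 := b.one_of_mem_closedBall (Metric.mem_closedBall_self b.rIn_pos.le)
    change ((b 0 : ℝ) : ℂ) = 0 at h2
    rw [h3] at h2
    simp at h2

end TestFn

/-! ### Failure of compactness -/

open TestFn in
theorem IsCanonicalSolutionOperator.not_isCompactOperator
    {S : WeightedL2 normSqWeight →L[ℂ] WeightedL2 normSqWeight}
    (hS : IsCanonicalSolutionOperator normSqWeight S) : ¬ IsCompactOperator S := by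
  intro hcomp
  obtain ⟨ψ, hsupp, hne⟩ := exists_support_subset_ball
  -- Centres 2n are at mutual distance at least 2, so the supports, lying in open unit balls, are
  -- disjoint.
  let χ : ℕ → TestFn := fun n => translate (2 * n : ℝ) ψ
  let x : ℕ → WeightedL2 normSqWeight := fun n => S (toL2 (χ n))
  have hsep : ∀ m n, m ≠ n → ‖toL2 ψ‖ ^ 2 ≤ ‖toL2 (dbarAdjoint ψ)‖ * ‖x m - x n‖ := by
    intro m n hmn
    have hweak := fun k => (isWeakDbar_iff_inner _ _).1 (hS (toL2 (χ k))).1 (χ m)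
    have hdist : 2 ≤ ‖(((2 * m : ℝ) : ℂ)) - ((2 * n : ℝ) : ℂ)‖ := by
      rw [← ofReal_sub, norm_real, ← mul_sub, norm_mul, Real.norm_ofNat, Real.norm_eq_abs]
      have : (1 : ℝ) ≤ |(m : ℝ) - n| := by
        exact_mod_cast Int.one_le_abs (sub_ne_zero.2 (Int.ofNat_inj.not.2 hmn))
      linarith
    -- The pairing equals ⟨χₘ, χₘ - χₙ⟩, whose second term vanishes by disjointness.
    have h1 : inner ℂ (toL2 (dbarAdjoint (χ m))) (x m - x n) = (‖toL2 ψ‖ : ℂ) ^ 2 := by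
      rw [inner_sub_right, hweak m, hweak n, inner_translate_eq_zero hsupp hdist, sub_zero,
        inner_translate]
      exact inner_self_eq_norm_sq_to_K _
    have h2 := norm_inner_le_norm (𝕜 := ℂ) (toL2 (dbarAdjoint (χ m))) (x m - x n)
    rw [h1, dbarAdjoint_translate, norm_translate, norm_pow, norm_real, norm_norm] at h2
    exact h2
  obtain ⟨K, hK, hSK⟩ := IsCompactOperator.image_closedBall_subset_compact
    (f := S.toLinearMap) hcomp ‖toL2 ψ‖
  obtain ⟨y, -, k, hk, hlim⟩ := hK.tendsto_subseq (x := x) fun n =>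
    hSK ⟨toL2 (χ n), by rw [mem_closedBall_zero_iff, norm_translate], rfl⟩
  have hpos : 0 < ‖toL2 ψ‖ ^ 2 := by positivity
  have hT : 0 < ‖toL2 (dbarAdjoint ψ)‖ := by
    have := ψ.norm_toL2_le
    have := norm_pos_iff.2 hne
    linarith
  -- A convergent subsequence would be Cauchy, against the separation ‖ψ‖² / ‖∂̄*ψ‖.
  obtain ⟨N, hN⟩ := Metric.cauchySeq_iff.1 hlim.cauchySeq _ (div_pos hpos hT)
  have h1 := hN N le_rfl (N + 1) (Nat.le_succ N)
  rw [dist_eq_norm, lt_div_iff₀ hT, mul_comm] at h1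
  exact absurd h1 (not_lt.2 (hsep _ _ (hk.injective.ne (Nat.lt_succ_self N).ne)))

/-- For `φ(z) = |z|²` the canonical solution operator to `∂̄` on `L²_φ` exists, is unique, and
fails to be compact. -/
theorem theorem2p2 :
    (∃! S : WeightedL2 (fun z : ℂ => ‖z‖ ^ 2) →L[ℂ] WeightedL2 (fun z : ℂ => ‖z‖ ^ 2),
      IsCanonicalSolutionOperator (fun z : ℂ => ‖z‖ ^ 2) S) ∧
    ∀ S : WeightedL2 (fun z : ℂ => ‖z‖ ^ 2) →L[ℂ] WeightedL2 (fun z : ℂ => ‖z‖ ^ 2),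
      IsCanonicalSolutionOperator (fun z : ℂ => ‖z‖ ^ 2) S → ¬ IsCompactOperator S :=
  ⟨⟨TestFn.canonicalSolution, TestFn.isCanonicalSolutionOperator_canonicalSolution,
    fun _ hS => hS.eq TestFn.isCanonicalSolutionOperator_canonicalSolution⟩,
    fun _ hS => hS.not_isCompactOperator⟩
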